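/- Identify subsets of $\omega$ with their characteristic functions in $2^{\omega}$, so that a filter on $\omega$ becomes a subset of $2^{\omega}$. Let $(p_n)_{n\in\omega}$ be a sequence of reals with $p_n\in(0,\tfrac12]$ for all $n$, and let $\mu_{\hat p}$ be the product measure on $2^{\omega}$ with $\mu_{\hat p}(\{x: x(n)=1\})=p_n$ and $\mu_{\hat p}(\{x: x(n)=0\})=1-p_n$ for all $n$ (if all $p_n=\tfrac12$, this is the usual Lebesgue measure on $2^\omega$). Let $\mathcal F$ be a proper nonprincipal filter on $\omega$ (that is, $\emptyset\notin\mathcal F$ and there is no $A\subseteq\omega$ with $\mathcal F=\{X\subseteq\omega: A\subseteq X\}$) which is a Borel, or more generally an analytic, subset of $2^{\omega}$. Then there is a set $K\subseteq 2^{\omega}$ of type $F_\sigma$ such that $\mu_{\hat p}(K)=0$ and $\mathcal F\subseteq K$. -/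

import Mathlib

open MeasureTheory ProbabilityTheory

/-- The family of (characteristic functions of) elements of a filter `F` on `ω`, as a subset of
the Cantor space `2^ω`. -/
def filterSet (F : Filter ℕ) : Set (ℕ → Bool) :=
  {x | {n | x n = true} ∈ F}

/-- The product measure on `2^ω` giving mass `p n` to `{x | x n = 1}` and mass `1 - p n` to
`{x | x n = 0}`. When `p n = 1/2` for all `n` it is the Lebesgue (coin-tossing) measure. -/
noncomputable def cantorMeasure (p : ℕ → unitInterval) : Measure (ℕ → Bool) :=
  Measure.infinitePi fun n => bernoulliMeasure true false (p n)

/-- A set of type `F_σ`: a countable union of closed sets. -/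
def IsFSigma {X : Type*} [TopologicalSpace X] (s : Set X) : Prop :=
  ∃ C : ℕ → Set X, (∀ n, IsClosed (C n)) ∧ s = ⋃ n, C n

open PiNat Set Function Topology

/-! Write the filter as the range of a continuous `f` on Baire space. If no null F_σ set covers the
range, deleting every cylinder with a coverable image leaves a nonempty kernel `P` all of whose
portions have images with closure of positive measure (`exists_null_isFSigma_or_kernel`). Inside
`P`, three members of the filter with finite intersection are built (`exists_range_inter_finite`),
and a filter containing a finite set is principal. The three members are approximated by nodes
taking turns. The moving node fixes more of its branch and jumps, by Lebesgue density, to a cylinder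
almost filled by its hull; its new bits are uncontrolled. Over the same coordinates the two resting
nodes are prolonged with disjoint supports, which is where `p n ≤ 1 / 2` enters, at a bounded loss
of density. So no new coordinate is 1 in all three. -/

instance (p : ℕ → unitInterval) : IsProbabilityMeasure (cantorMeasure p) := by
  unfold cantorMeasure; infer_instance

/-! ### Cylinders and relative measure -/

/-- The conditional probability of `E` given that `x` is followed up to `n`. -/
noncomputable def relMeasure (p : ℕ → unitInterval) (E : Set (ℕ → Bool)) (x : ℕ → Bool) (n : ℕ) :
    ℝ :=
  (cantorMeasure p).real (cylinder x n ∩ E) / (cantorMeasure p).real (cylinder x n)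

theorem cantorMeasure_real_cylinder (p : ℕ → unitInterval) (x : ℕ → Bool) (n : ℕ) :
    (cantorMeasure p).real (cylinder x n) =
      ∏ i ∈ Finset.range n, if x i = true then (p i : ℝ) else 1 - p i := by
  rw [cylinder_eq_pi, measureReal_def, cantorMeasure,
    Measure.infinitePi_pi _ (fun i _ => measurableSet_singleton _), ENNReal.toReal_prod]
  refine Finset.prod_congr rfl fun i _ => ?_
  rw [← measureReal_def, bernoulliMeasure_real_apply _ (measurableSet_singleton _)]
  cases x i <;> simp

theorem cantorMeasure_real_cylinder_update (p : ℕ → unitInterval) (x : ℕ → Bool) (n : ℕ)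
    (b : Bool) :
    (cantorMeasure p).real (cylinder (update x n b) (n + 1)) =
      (cantorMeasure p).real (cylinder x n) * if b = true then (p n : ℝ) else 1 - p n := by
  rw [cantorMeasure_real_cylinder, cantorMeasure_real_cylinder, Finset.prod_range_succ,
    update_self]
  congr 1
  refine Finset.prod_congr rfl fun i hi => ?_
  rw [update_of_ne (Finset.mem_range.1 hi).ne]

theorem isClopen_cylinder (x : ℕ → Bool) (n : ℕ) : IsClopen (cylinder x n) := by
  refine ⟨?_, isOpen_cylinder _ x n⟩
  rw [cylinder_eq_pi]
  exact isClosed_set_pi fun _ _ => isClosed_discrete _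

theorem cylinder_eq_union_update (x : ℕ → Bool) (n : ℕ) :
    cylinder x n = cylinder (update x n true) (n + 1) ∪ cylinder (update x n false) (n + 1) := by
  rw [← iUnion_cylinder_update x n]
  ext y
  simp [or_comm]

theorem disjoint_cylinder_update (x : ℕ → Bool) (n : ℕ) :
    Disjoint (cylinder (update x n true) (n + 1)) (cylinder (update x n false) (n + 1)) := by
  rw [Set.disjoint_left]
  intro y h1 h2
  have h1 := h1 n n.lt_succ_self
  have h2 := h2 n n.lt_succ_self
  simp_all

theorem cylinder_subset_cylinder {E : ℕ → Type*} {x y : ∀ n, E n} {m n : ℕ} (h : m ≤ n)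
    (hy : y ∈ cylinder x m) : cylinder y n ⊆ cylinder x m :=
  fun _ hz i hi => (hz i (hi.trans_le h)).trans (hy i hi)

section Positive

variable {p : ℕ → unitInterval}

theorem cantorMeasure_real_cylinder_pos
    (hp : ∀ n, 0 < (p n : ℝ) ∧ (p n : ℝ) ≤ 1 / 2)
    (x : ℕ → Bool) (n : ℕ) :
    0 < (cantorMeasure p).real (cylinder x n) := by
  rw [cantorMeasure_real_cylinder]
  refine Finset.prod_pos fun i _ => ?_
  have := hp i
  split_ifs <;> linarith

theorem relMeasure_split
    (hp : ∀ n, 0 < (p n : ℝ) ∧ (p n : ℝ) ≤ 1 / 2)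
    {E : Set (ℕ → Bool)} (hE : MeasurableSet E) (x : ℕ → Bool) (n : ℕ) :
    relMeasure p E x n = p n * relMeasure p E (update x n true) (n + 1) +
      (1 - p n) * relMeasure p E (update x n false) (n + 1) := by
  have h : (cantorMeasure p).real (cylinder x n ∩ E) =
      (cantorMeasure p).real (cylinder (update x n true) (n + 1) ∩ E) +
      (cantorMeasure p).real (cylinder (update x n false) (n + 1) ∩ E) := by
    rw [cylinder_eq_union_update, union_inter_distrib_right, measureReal_union]
    · exact (disjoint_cylinder_update x n).mono inter_subset_left inter_subset_left
    · exact (isOpen_cylinder _ _ _).measurableSet.inter hE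
  have := hp n
  have hm := cantorMeasure_real_cylinder_pos hp x n
  have : (1 : ℝ) - p n ≠ 0 := by linarith
  have : (p n : ℝ) ≠ 0 := by linarith
  simp only [relMeasure, cantorMeasure_real_cylinder_update, h]
  simp
  field_simp

theorem relMeasure_compl
    (hp : ∀ n, 0 < (p n : ℝ) ∧ (p n : ℝ) ≤ 1 / 2)
    {E : Set (ℕ → Bool)} (hE : MeasurableSet E) (x : ℕ → Bool) (n : ℕ) :
    relMeasure p Eᶜ x n = 1 - relMeasure p E x n := by
  have hm := cantorMeasure_real_cylinder_pos hp x n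
  have h := measureReal_inter_add_sdiff (μ := cantorMeasure p) (s := PiNat.cylinder x n) hE
  rw [relMeasure, relMeasure, ← sdiff_eq, eq_sub_iff_add_eq, ← add_div, add_comm, h, div_self hm.ne']

theorem relMeasure_nonneg (E : Set (ℕ → Bool)) (x : ℕ → Bool) (n : ℕ) :
    0 ≤ relMeasure p E x n := by
  unfold relMeasure; positivity

/-! ### Prolonging two points with disjoint supports -/

/-- Coupling of two coordinates with disjoint supports, which exists since `p n ≤ 1 / 2`. -/
theorem exists_update_relMeasure_le
    (hp : ∀ n, 0 < (p n : ℝ) ∧ (p n : ℝ) ≤ 1 / 2)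
    {E E' : Set (ℕ → Bool)} (hE : MeasurableSet E)
    (hE' : MeasurableSet E') (x y : ℕ → Bool) (n : ℕ) (s t : ℝ) :
    ∃ b c : Bool, ¬ (b = true ∧ c = true) ∧
      s * relMeasure p E (update x n b) (n + 1) + t * relMeasure p E' (update y n c) (n + 1) ≤
        s * relMeasure p E x n + t * relMeasure p E' y n := by
  rw [relMeasure_split hp hE x, relMeasure_split hp hE' y]
  obtain ⟨h0, h1⟩ := hp n
  -- The pairs (1,0), (0,1), (0,0) get weights `p n`, `p n`, `1 - 2 * p n`, which have the right
  -- marginals; some pair does no worse than the average.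
  by_contra! h
  have h10 := mul_lt_mul_of_pos_left (h true false (by simp)) h0
  have h01 := mul_lt_mul_of_pos_left (h false true (by simp)) h0
  have h00 := mul_le_mul_of_nonneg_left (h false false (by simp)).le
    (by linarith : 0 ≤ 1 - 2 * (p n : ℝ))
  linarith

theorem exists_disjoint_extension
    (hp : ∀ n, 0 < (p n : ℝ) ∧ (p n : ℝ) ≤ 1 / 2)
    {E E' : Set (ℕ → Bool)} (hE : MeasurableSet E)
    (hE' : MeasurableSet E') (x y : ℕ → Bool) {n m : ℕ} (hnm : n ≤ m) (s t : ℝ) :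
    ∃ x' ∈ cylinder x n, ∃ y' ∈ cylinder y n,
      (∀ i, n ≤ i → i < m → ¬ (x' i = true ∧ y' i = true)) ∧
      s * relMeasure p E x' m + t * relMeasure p E' y' m ≤
        s * relMeasure p E x n + t * relMeasure p E' y n := by
  induction m, hnm using Nat.le_induction with
  | base =>
    exact ⟨x, self_mem_cylinder _ _, y, self_mem_cylinder _ _, fun i h h' => by omega, le_rfl⟩
  | succ m hnm ih =>
    obtain ⟨x', hx, y', hy, hd, hle⟩ := ih
    obtain ⟨b, c, hbc, hle'⟩ := exists_update_relMeasure_le hp hE hE' x' y' m s t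
    refine ⟨update x' m b, fun i hi => ?_, update y' m c, fun i hi => ?_, fun i hi hi' => ?_,
      hle'.trans hle⟩
    · rw [update_of_ne (by omega), hx i hi]
    · rw [update_of_ne (by omega), hy i hi]
    · rcases Nat.lt_succ_iff_lt_or_eq.1 hi' with h | rfl
      · rw [update_of_ne h.ne, update_of_ne h.ne]
        exact hd i hi h
      · simpa using hbc

/-! ### Lebesgue density for closed sets -/

/-- A positive proportion of a cylinder in a closed set yields a subcylinder that is almost full. -/
theorem exists_relMeasure_compl_le
    (hp : ∀ n, 0 < (p n : ℝ) ∧ (p n : ℝ) ≤ 1 / 2)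
    {C : Set (ℕ → Bool)} (hC : IsClosed C) {x : ℕ → Bool} {n : ℕ}
    (hpos : 0 < relMeasure p C x n) {ε : ℝ} (hε : 0 < ε) :
    ∃ x' ∈ cylinder x n, ∃ m, n ≤ m ∧ relMeasure p Cᶜ x' m ≤ ε := by
  by_contra! hcon
  replace hcon : ∀ y ∈ cylinder x n, ∀ m, n ≤ m → relMeasure p C y m ≤ 1 - ε := fun y hy m hm => by
    have := hcon y hy m hm
    rw [relMeasure_compl hp hC.measurableSet] at this
    linarith
  have hε1 : 0 ≤ 1 - ε :=
    (relMeasure_nonneg C x n).trans (hcon x (self_mem_cylinder _ _) n le_rfl)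
  -- The clopen neighbourhoods `N k` decrease to `C`. If `C` has density at most `1 - ε` in every
  -- subcylinder, then its measure is at most `1 - ε` times that of `N k`, and the limit contradicts
  -- positivity.
  let N : ℕ → Set (ℕ → Bool) := fun k => ⋃ z ∈ C, cylinder z k
  have hN : ∀ k, MeasurableSet (N k) := fun k =>
    (isOpen_biUnion fun z _ => isOpen_cylinder _ z k).measurableSet
  have key : ∀ j, ∀ y ∈ cylinder x n, ∀ m, n ≤ m →
      relMeasure p C y m ≤ (1 - ε) * relMeasure p (N (m + j)) y m := by
    intro j
    induction j with
    | zero =>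
      intro y hy m hm
      rcases (cylinder y m ∩ C).eq_empty_or_nonempty with h | ⟨z, hz, hzC⟩
      · have : relMeasure p C y m = 0 := by simp [relMeasure, h]
        rw [this]
        exact mul_nonneg hε1 (relMeasure_nonneg _ _ _)
      · have hsub : cylinder y m ⊆ N m :=
          fun w hw => mem_biUnion hzC fun i hi => (hw i hi).trans (hz i hi).symm
        have : relMeasure p (N (m + 0)) y m = 1 := by
          rw [add_zero, relMeasure, inter_eq_left.2 hsub,
            div_self (cantorMeasure_real_cylinder_pos hp y m).ne']
        rw [this, mul_one]
        exact hcon y hy m hm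
    | succ j ih =>
      intro y hy m hm
      rw [relMeasure_split hp hC.measurableSet, relMeasure_split hp (hN _)]
      have hu : ∀ b, update y m b ∈ cylinder x n := fun b i hi => by
        rw [update_of_ne (by omega), hy i hi]
      have h1 := ih _ (hu true) (m + 1) (by omega)
      have h0 := ih _ (hu false) (m + 1) (by omega)
      rw [show m + 1 + j = m + (j + 1) by ring] at h1 h0
      obtain ⟨q0, q1⟩ := hp m
      have e1 := mul_le_mul_of_nonneg_left h1 q0.le
      have e0 := mul_le_mul_of_nonneg_left h0 (by linarith : 0 ≤ 1 - (p m : ℝ))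
      linarith
  have hanti : Antitone fun k => cylinder x n ∩ N k := fun k l hkl =>
    inter_subset_inter_right _ (biUnion_mono Subset.rfl fun z _ => cylinder_anti z hkl)
  have hinter : ⋂ k, cylinder x n ∩ N k = cylinder x n ∩ C := by
    rw [← inter_iInter]
    congr 1
    refine Subset.antisymm (fun y hy => ?_) fun y hy =>
      mem_iInter.2 fun k => mem_biUnion hy (self_mem_cylinder _ _)
    by_contra hyC
    obtain ⟨k, hk⟩ := exists_disjoint_cylinder hC hyC
    obtain ⟨z, hzC, hz⟩ := mem_iUnion₂.1 (mem_iInter.1 hy k)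
    exact Set.disjoint_left.1 hk hzC ((mem_cylinder_comm _ _ _).1 hz)
  have hlim : Filter.Tendsto (fun k => relMeasure p (N k) x n) Filter.atTop
      (𝓝 (relMeasure p C x n)) := by
    refine Filter.Tendsto.div_const ?_ _
    have := tendsto_measure_iInter_atTop (μ := cantorMeasure p)
      (fun k => ((isOpen_cylinder _ x n).measurableSet.inter (hN k)).nullMeasurableSet) hanti
      ⟨0, measure_ne_top _ _⟩
    rw [hinter] at this
    exact (ENNReal.tendsto_toReal (measure_ne_top _ _)).comp this
  have hle : relMeasure p C x n ≤ (1 - ε) * relMeasure p C x n := by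
    refine ge_of_tendsto (hlim.const_mul _) (Filter.eventually_atTop.2 ⟨n, fun k hk => ?_⟩)
    obtain ⟨j, rfl⟩ := Nat.exists_eq_add_of_le hk
    exact key j x (self_mem_cylinder _ _) n le_rfl
  nlinarith

/-- Passing first to a child that `C` charges makes the length strictly larger. -/
theorem exists_lt_relMeasure_compl_le
    (hp : ∀ n, 0 < (p n : ℝ) ∧ (p n : ℝ) ≤ 1 / 2)
    {C : Set (ℕ → Bool)} (hC : IsClosed C) {x : ℕ → Bool}
    {n : ℕ} (hpos : 0 < relMeasure p C x n) {ε : ℝ} (hε : 0 < ε) :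
    ∃ x' ∈ cylinder x n, ∃ m, n < m ∧ relMeasure p Cᶜ x' m ≤ ε := by
  obtain ⟨b, hb⟩ : ∃ b, 0 < relMeasure p C (update x n b) (n + 1) := by
    by_contra! h
    rw [relMeasure_split hp hC.measurableSet] at hpos
    obtain ⟨q0, q1⟩ := hp n
    have e1 := mul_le_mul_of_nonneg_left (h true) q0.le
    have e0 := mul_le_mul_of_nonneg_left (h false) (by linarith : 0 ≤ 1 - (p n : ℝ))
    linarith
  obtain ⟨x', hx', m, hm, h⟩ := exists_relMeasure_compl_le hp hC hb hε
  exact ⟨x', cylinder_subset_cylinder n.le_succ (update_mem_cylinder x n b) hx', m, hm, h⟩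

end Positive

/-! ### The construction with three nodes -/

/-- A stage in the construction of a point of the range of a map from Baire space to Cantor space:
an initial segment of the argument and an approximation of the value. -/
structure BranchNode where
  branch : ℕ → ℕ
  depth : ℕ
  point : ℕ → Bool

namespace BranchNode

/-- The closure of the image of the part of `P` that follows the branch. -/
def hull (f : (ℕ → ℕ) → ℕ → Bool) (P : Set (ℕ → ℕ)) (A : BranchNode) : Set (ℕ → Bool) :=
  closure (f '' (P ∩ cylinder A.branch A.depth))

/-- The hull fills the cylinder of length `n` around the point up to a proportion of `q`. -/
def Fills (p : ℕ → unitInterval) (f : (ℕ → ℕ) → ℕ → Bool) (P : Set (ℕ → ℕ)) (n : ℕ) (q : ℝ)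
    (A : BranchNode) : Prop :=
  relMeasure p (A.hull f P)ᶜ A.point n ≤ q

/-- The node `B` of length `m` extends the node `A` of length `n`. -/
def Extends (n : ℕ) (A : BranchNode) (m : ℕ) (B : BranchNode) : Prop :=
  n ≤ m ∧ B.branch ∈ cylinder A.branch A.depth ∧ A.depth ≤ B.depth ∧ B.point ∈ cylinder A.point n

/-- The node `B` extends `A` and its branch decides the value of `f` up to the length of `A`. -/
def Decides (f : (ℕ → ℕ) → ℕ → Bool) (n : ℕ) (A : BranchNode) (m : ℕ) (B : BranchNode) : Prop :=
  Extends n A m B ∧ A.depth < B.depth ∧ MapsTo f (cylinder B.branch B.depth) (cylinder A.point n)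

theorem Extends.trans {n m k : ℕ} {A B D : BranchNode} (h : Extends n A m B)
    (h' : Extends m B k D) : Extends n A k D :=
  ⟨h.1.trans h'.1, cylinder_subset_cylinder h.2.2.1 h.2.1 h'.2.1, h.2.2.1.trans h'.2.2.1,
    cylinder_subset_cylinder h.1 h.2.2.2 h'.2.2.2⟩

theorem Decides.trans_extends {f : (ℕ → ℕ) → ℕ → Bool} {n m k : ℕ} {A B D : BranchNode}
    (h : Decides f n A m B) (h' : Extends m B k D) : Decides f n A k D :=
  ⟨h.1.trans h', h.2.1.trans_le h'.2.2.1,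
    h.2.2.mono_left (cylinder_subset_cylinder h'.2.2.1 h'.2.1)⟩

theorem Extends.trans_decides {f : (ℕ → ℕ) → ℕ → Bool} {n m k : ℕ} {A B D : BranchNode}
    (h : Extends n A m B) (h' : Decides f m B k D) : Decides f n A k D :=
  ⟨h.trans h'.1, h.2.2.1.trans_lt h'.2.1,
    h'.2.2.mono_right (cylinder_subset_cylinder h.1 h.2.2.2)⟩

variable {p : ℕ → unitInterval} {f : (ℕ → ℕ) → ℕ → Bool} {P : Set (ℕ → ℕ)}

theorem measurableSet_hull_compl (A : BranchNode) : MeasurableSet (A.hull f P)ᶜ :=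
  isClosed_closure.measurableSet.compl

/-- The hull meets the cylinder, so some `f a` with `a ∈ P` on the branch lies in it. By continuity
a longer piece of `a` keeps all values there, and the closure of its image is not null by the choice
of `P`, so density applies. -/
theorem exists_decides
    (hp : ∀ n, 0 < (p n : ℝ) ∧ (p n : ℝ) ≤ 1 / 2) (hf : Continuous f)
    (hP : ∀ a ∈ P, ∀ j, cantorMeasure p (closure (f '' (P ∩ cylinder a j))) ≠ 0)
    {n : ℕ} {A : BranchNode} {q : ℝ} (hA : A.Fills p f P n q) (hq : q < 1)
    {ε : ℝ} (hε : 0 < ε) :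
    ∃ m B, n < m ∧ Decides f n A m B ∧ B.Fills p f P m ε := by
  have hpos : 0 < relMeasure p (A.hull f P) A.point n := by
    have h := relMeasure_compl hp (E := A.hull f P) isClosed_closure.measurableSet A.point n
    unfold Fills at hA
    linarith
  have hne : (cylinder A.point n ∩ A.hull f P).Nonempty := by
    by_contra h
    rw [not_nonempty_iff_eq_empty] at h
    simp [relMeasure, h] at hpos
  obtain ⟨y, hy, hyA⟩ := hne
  obtain ⟨_, hw, a, ⟨haP, ha⟩, rfl⟩ := mem_closure_iff.1 hyA _ (isOpen_cylinder _ A.point n) hy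
  obtain ⟨_, ⟨z, k, rfl⟩, haz, hk⟩ := (isTopologicalBasis_cylinders fun _ : ℕ => ℕ).mem_nhds_iff.1
    (((isOpen_cylinder _ A.point n).preimage hf).mem_nhds hw)
  rw [← mem_cylinder_iff_eq.1 haz] at hk
  -- The `+ 1` makes depths grow strictly, so that the branches converge.
  set j := max k (A.depth + 1)
  have hsub : MapsTo f (cylinder a j) (cylinder A.point n) :=
    fun b hb => hk (cylinder_anti a (le_max_left _ _) hb)
  set C := closure (f '' (P ∩ cylinder a j)) with hC
  have hCsub : C ⊆ cylinder A.point n :=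
    closure_minimal (image_subset_iff.2 fun b hb => hsub hb.2) (isClopen_cylinder _ _).1
  have hCpos : 0 < relMeasure p C A.point n := by
    refine div_pos ?_ (cantorMeasure_real_cylinder_pos hp _ _)
    rw [inter_eq_right.2 hCsub]
    exact ENNReal.toReal_pos (hP a haP j) (measure_ne_top _ _)
  obtain ⟨x, hx, m, hnm, hm⟩ := exists_lt_relMeasure_compl_le hp isClosed_closure hCpos hε
  have hj : A.depth < j := (Nat.lt_succ_self _).trans_le (le_max_right _ _)
  exact ⟨m, ⟨a, j, x⟩, hnm, ⟨⟨hnm.le, ha, hj.le, hx⟩, hj, hsub⟩, hm⟩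

/-- `A` moves while `B` and `D` rest. The deficits 1/2, 1/4, 1/8 reappear in the order `B`, `D`,
`A`, so turns can be repeated cyclically. -/
theorem exists_turn
    (hp : ∀ n, 0 < (p n : ℝ) ∧ (p n : ℝ) ≤ 1 / 2) (hf : Continuous f)
    (hP : ∀ a ∈ P, ∀ j, cantorMeasure p (closure (f '' (P ∩ cylinder a j))) ≠ 0)
    {n : ℕ} {A B D : BranchNode} (hA : A.Fills p f P n (1 / 2))
    (hB : B.Fills p f P n (1 / 4)) (hD : D.Fills p f P n (1 / 8)) :
    ∃ m A' B' D', n < m ∧ Decides f n A m A' ∧ Extends n B m B' ∧ Extends n D m D' ∧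
      (∀ i, n ≤ i → i < m → ¬ (B'.point i = true ∧ D'.point i = true)) ∧
      B'.Fills p f P m (1 / 2) ∧ D'.Fills p f P m (1 / 4) ∧ A'.Fills p f P m (1 / 8) := by
  obtain ⟨m, A', hnm, hAA', hA'⟩ :=
    exists_decides hp hf hP hA (by norm_num) (by norm_num : (0 : ℝ) < 1 / 8)
  -- With weights 4 and 8 the initial sum is at most 4 · 1/4 + 8 · 1/8 = 2, which bounds the new
  -- deficits by 2/4 and 2/8.
  obtain ⟨x, hx, y, hy, hxy, hle⟩ := exists_disjoint_extension hp
    (B.measurableSet_hull_compl (f := f) (P := P)) (D.measurableSet_hull_compl (f := f) (P := P))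
    B.point D.point hnm.le 4 8
  refine ⟨m, A', ⟨B.branch, B.depth, x⟩, ⟨D.branch, D.depth, y⟩, hnm, hAA',
    ⟨hnm.le, self_mem_cylinder _ _, le_rfl, hx⟩, ⟨hnm.le, self_mem_cylinder _ _, le_rfl, hy⟩,
    hxy, ?_, ?_, hA'⟩
  all_goals
    have h1 := relMeasure_nonneg (p := p) (B.hull f P)ᶜ x m
    have h2 := relMeasure_nonneg (p := p) (D.hull f P)ᶜ y m
    unfold Fills at *
  · change relMeasure p (B.hull f P)ᶜ x m ≤ 1 / 2
    linarith
  · change relMeasure p (D.hull f P)ᶜ y m ≤ 1 / 4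
    linarith

/-- Three nodes of length `n` ready for the next round, in which they move in order. -/
def Ready (p : ℕ → unitInterval) (f : (ℕ → ℕ) → ℕ → Bool) (P : Set (ℕ → ℕ))
    (n : ℕ) (A B D : BranchNode) : Prop :=
  A.Fills p f P n (1 / 2) ∧ B.Fills p f P n (1 / 4) ∧ D.Fills p f P n (1 / 8)

theorem exists_round
    (hp : ∀ n, 0 < (p n : ℝ) ∧ (p n : ℝ) ≤ 1 / 2) (hf : Continuous f)
    (hP : ∀ a ∈ P, ∀ j, cantorMeasure p (closure (f '' (P ∩ cylinder a j))) ≠ 0)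
    {n : ℕ} {A B D : BranchNode} (h : Ready p f P n A B D) :
    ∃ m A' B' D', Ready p f P m A' B' D' ∧ n < m ∧
      Decides f n A m A' ∧ Decides f n B m B' ∧ Decides f n D m D' ∧
      ∀ i, n ≤ i → i < m → ¬ (A'.point i = true ∧ B'.point i = true ∧ D'.point i = true) := by
  obtain ⟨k, A₁, B₁, D₁, hk, hA₁, hB₁, hD₁, hd₁, r₁, s₁, t₁⟩ :=
    exists_turn hp hf hP h.1 h.2.1 h.2.2
  obtain ⟨l, B₂, D₂, A₂, hl, hB₂, hD₂, hA₂, hd₂, r₂, s₂, t₂⟩ := exists_turn hp hf hP r₁ s₁ t₁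
  obtain ⟨m, D₃, A₃, B₃, hm, hD₃, hA₃, hB₃, hd₃, r₃, s₃, t₃⟩ := exists_turn hp hf hP r₂ s₂ t₂
  refine ⟨m, A₃, B₃, D₃, ⟨r₃, s₃, t₃⟩, by omega, hA₁.trans_extends (hA₂.trans hA₃),
    (hB₁.trans_decides hB₂).trans_extends hB₃, (hD₁.trans hD₂).trans_decides hD₃, ?_⟩
  -- The resting pairs are `B`, `D` below `k`, then `D`, `A` below `l`, then `A`, `B` below `m`;
  -- later turns leave settled bits unchanged.
  rintro i hi hi' ⟨ha, hb, hd⟩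
  by_cases h2 : l ≤ i
  · exact hd₃ i h2 hi' ⟨ha, hb⟩
  have ha₂ := hA₃.2.2.2 i (by omega)
  have hd₂' := hD₃.1.2.2.2 i (by omega)
  have hb₂ := hB₃.2.2.2 i (by omega)
  by_cases h1 : k ≤ i
  · exact hd₂ i h1 (by omega) ⟨hd₂' ▸ hd, ha₂ ▸ ha⟩
  have hb₁ := hB₂.1.2.2.2 i (by omega)
  have hd₁' := hD₂.2.2.2 i (by omega)
  refine hd₁ i hi (by omega) ⟨?_, ?_⟩
  · rw [← hb₁, ← hb₂, hb]
  · rw [← hd₁', ← hd₂', hd]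

/-- A sequence of nodes that decide one another converges to a point of the range of `f`. -/
theorem exists_limit {f : (ℕ → ℕ) → ℕ → Bool} {n : ℕ → ℕ} {A : ℕ → BranchNode}
    (h : ∀ k, Decides f (n k) (A k) (n (k + 1)) (A (k + 1))) :
    ∃ x ∈ range f, ∀ k, x ∈ cylinder (A k).point (n k) := by
  have hdepth : StrictMono fun k => (A k).depth := strictMono_nat_of_lt_succ fun k => (h k).2.1
  have hext : ∀ k l, k ≤ l → Extends (n k) (A k) (n l) (A l) := by
    intro k l hkl
    induction l, hkl using Nat.le_induction with
    | base => exact ⟨le_rfl, self_mem_cylinder _ _, le_rfl, self_mem_cylinder _ _⟩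
    | succ l _ ih => exact ih.trans (h l).1
  -- The depth of `A (i + 1)` is at least `i + 1`, so entry `i` is already final there.
  let a : ℕ → ℕ := fun i => (A (i + 1)).branch i
  have ha : ∀ k, a ∈ cylinder (A k).branch (A k).depth := by
    intro k i hi
    rcases le_total k (i + 1) with hk | hk
    · exact (hext k _ hk).2.1 i hi
    · have : i < (A (i + 1)).depth := i.lt_succ_self.trans_le (hdepth.le_apply (x := i + 1))
      exact ((hext _ k hk).2.1 i this).symm
  exact ⟨f a, mem_range_self a, fun k => (h k).2.2 (ha (k + 1))⟩

theorem exists_range_inter_finite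
    (hp : ∀ n, 0 < (p n : ℝ) ∧ (p n : ℝ) ≤ 1 / 2) (hf : Continuous f)
    (hP : ∀ a ∈ P, ∀ j, cantorMeasure p (closure (f '' (P ∩ cylinder a j))) ≠ 0)
    (hne : P.Nonempty) :
    ∃ x ∈ range f, ∃ y ∈ range f, ∃ z ∈ range f,
      {i | x i = true ∧ y i = true ∧ z i = true}.Finite := by
  obtain ⟨a, ha⟩ := hne
  obtain ⟨x₀, -, n₀, -, h₀⟩ := exists_relMeasure_compl_le hp (x := fun _ => true) (n := 0)
    (isClosed_closure (s := f '' (P ∩ cylinder a 0))) (div_pos (by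
      rw [cylinder_zero, univ_inter]
      exact ENNReal.toReal_pos (hP a ha 0) (measure_ne_top _ _))
      (cantorMeasure_real_cylinder_pos hp _ _)) (by norm_num : (0 : ℝ) < 1 / 8)
  let A₀ : BranchNode := ⟨a, 0, x₀⟩
  have h₀ : A₀.Fills p f P n₀ (1 / 8) := h₀
  -- All three nodes start equal, so common 1s can occur only below `n₀`.
  have hready : Ready p f P n₀ A₀ A₀ A₀ :=
    ⟨h₀.trans (by norm_num), h₀.trans (by norm_num), h₀⟩
  let S := {s : ℕ × BranchNode × BranchNode × BranchNode // Ready p f P s.1 s.2.1 s.2.2.1 s.2.2.2}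
  have hstep : ∀ s : S, ∃ t : S, s.1.1 < t.1.1 ∧ Decides f s.1.1 s.1.2.1 t.1.1 t.1.2.1 ∧
      Decides f s.1.1 s.1.2.2.1 t.1.1 t.1.2.2.1 ∧ Decides f s.1.1 s.1.2.2.2 t.1.1 t.1.2.2.2 ∧
      ∀ i, s.1.1 ≤ i → i < t.1.1 → ¬ (t.1.2.1.point i = true ∧ t.1.2.2.1.point i = true ∧
        t.1.2.2.2.point i = true) := by
    rintro ⟨⟨n, A, B, D⟩, h⟩
    obtain ⟨m, A', B', D', h', hrest⟩ := exists_round hp hf hP h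
    exact ⟨⟨⟨m, A', B', D'⟩, h'⟩, hrest⟩
  choose next hlt hA hB hD hdisj using hstep
  let s : ℕ → S := fun k => Nat.rec ⟨⟨n₀, A₀, A₀, A₀⟩, hready⟩ (fun _ t => next t) k
  have hmono : StrictMono fun k => (s k).1.1 := strictMono_nat_of_lt_succ fun k => hlt (s k)
  obtain ⟨x, hx, hx'⟩ := exists_limit (A := fun k => (s k).1.2.1) fun k => hA (s k)
  obtain ⟨y, hy, hy'⟩ := exists_limit (A := fun k => (s k).1.2.2.1) fun k => hB (s k)
  obtain ⟨z, hz, hz'⟩ := exists_limit (A := fun k => (s k).1.2.2.2) fun k => hD (s k)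
  refine ⟨x, hx, y, hy, z, hz, (finite_Iio n₀).subset ?_⟩
  rintro i ⟨hxi, hyi, hzi⟩
  by_contra hi
  have hex : ∃ k, i < (s k).1.1 := ⟨i + 1, i.lt_succ_self.trans_le (hmono.le_apply (x := i + 1))⟩
  obtain ⟨k, hk, hk'⟩ : ∃ k, (s k).1.1 ≤ i ∧ i < (s (k + 1)).1.1 := by
    classical
    have h1 := Nat.find_spec hex
    rcases h : Nat.find hex with _ | k
    · rw [h] at h1
      exact absurd h1 hi
    · rw [h] at h1
      exact ⟨k, not_lt.1 (Nat.find_min hex (by omega)), h1⟩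
  refine hdisj (s k) i hk hk' ⟨?_, ?_, ?_⟩
  · exact (hx' (k + 1) i hk').symm.trans hxi
  · exact (hy' (k + 1) i hk').symm.trans hyi
  · exact (hz' (k + 1) i hk').symm.trans hzi

end BranchNode

/-! ### F_σ sets, principal filters and the kernel -/

theorem isFSigma_iUnion {X : Type*} [TopologicalSpace X] {s : ℕ → Set X}
    (hs : ∀ n, IsFSigma (s n)) : IsFSigma (⋃ n, s n) := by
  choose C hC hsC using hs
  refine ⟨fun k => C k.unpair.1 k.unpair.2, fun k => hC _ _, ?_⟩
  rw [iUnion_unpair (fun i j => C i j)]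
  exact iUnion_congr hsC

theorem IsClosed.isFSigma {X : Type*} [TopologicalSpace X] {s : Set X} (hs : IsClosed s) :
    IsFSigma s :=
  ⟨fun _ => s, fun _ => hs, (iUnion_const s).symm⟩

/-- Only finitely many members lie below `s`, so their intersection is the least member. -/
theorem Filter.exists_eq_principal_of_finite_mem {α : Type*} {F : Filter α} {s : Set α}
    (hs : s.Finite) (hsF : s ∈ F) : ∃ t, F = Filter.principal t := by
  have hfin : {t | t ∈ F ∧ t ⊆ s}.Finite := hs.finite_subsets.subset fun t ht => ht.2
  refine ⟨⋂₀ {t | t ∈ F ∧ t ⊆ s}, le_antisymm ?_ fun u hu => ?_⟩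
  · exact Filter.le_principal_iff.2 ((Filter.sInter_mem hfin).2 fun t ht => ht.1)
  · exact Filter.mem_principal.2 fun y hy =>
      (hy (u ∩ s) ⟨Filter.inter_mem hu hsF, inter_subset_right⟩).1

/-- Either the range of `f` is covered by a null `F_σ` set, or `f` has a nonempty kernel on which
it is nowhere so covered. -/
theorem exists_null_isFSigma_or_kernel (p : ℕ → unitInterval) (f : (ℕ → ℕ) → ℕ → Bool) :
    (∃ K, IsFSigma K ∧ cantorMeasure p K = 0 ∧ range f ⊆ K) ∨
      ∃ P : Set (ℕ → ℕ), P.Nonempty ∧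
        ∀ a ∈ P, ∀ j, cantorMeasure p (closure (f '' (P ∩ cylinder a j))) ≠ 0 := by
  let Small : Set (ℕ → Bool) → Prop := fun s => ∃ K, IsFSigma K ∧ cantorMeasure p K = 0 ∧ s ⊆ K
  have hmono : ∀ {s t}, s ⊆ t → Small t → Small s :=
    fun hst ⟨K, h1, h2, h3⟩ => ⟨K, h1, h2, hst.trans h3⟩
  have hunion : ∀ s : ℕ → Set (ℕ → Bool), (∀ n, Small (s n)) → Small (⋃ n, s n) := by
    intro s hs
    choose K h1 h2 h3 using hs
    exact ⟨⋃ n, K n, isFSigma_iUnion h1, measure_iUnion_null h2, iUnion_mono h3⟩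
  have hclosed : ∀ s, cantorMeasure p (closure s) = 0 → Small s :=
    fun s h => ⟨closure s, isClosed_closure.isFSigma, h, subset_closure⟩
  let 𝒱 : Set (Set (ℕ → ℕ)) := {V | (∃ a j, V = PiNat.cylinder a j) ∧ Small (f '' V)}
  let W : Set (ℕ → ℕ) := ⋃₀ 𝒱
  have hW : Small (f '' W) := by
    -- By the Lindelöf property countably many of these cylinders suffice, and small sets form a
    -- σ-ideal.
    obtain ⟨T, hT, hTV, hTW⟩ := TopologicalSpace.isOpen_sUnion_countable 𝒱 (by
      rintro _ ⟨⟨a, j, rfl⟩, -⟩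
      exact isOpen_cylinder _ a j)
    rcases T.eq_empty_or_nonempty with rfl | hne
    · refine hclosed _ ?_
      simp [W, ← hTW]
    obtain ⟨V, rfl⟩ := hT.exists_eq_range hne
    have : f '' W = ⋃ n, f '' V n := by
      rw [← image_iUnion, ← sUnion_range, hTW]
    rw [this]
    exact hunion _ fun n => (hTV (mem_range_self n)).2
  by_cases hne : Wᶜ.Nonempty
  · refine Or.inr ⟨Wᶜ, hne, fun a ha j h0 => ha ?_⟩
    refine mem_sUnion.2 ⟨cylinder a j, ⟨⟨a, j, rfl⟩, ?_⟩, self_mem_cylinder _ _⟩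
    -- If a portion of `Wᶜ` had an image with null closure, the whole cylinder would have a small
    -- image and so lie inside `W`.
    refine hmono ?_ (hunion (fun n => if n = 0 then f '' W else f '' (Wᶜ ∩ cylinder a j)) ?_)
    · rintro _ ⟨b, hb, rfl⟩
      by_cases hbW : b ∈ W
      · exact mem_iUnion.2 ⟨0, mem_image_of_mem f hbW⟩
      · exact mem_iUnion.2 ⟨1, mem_image_of_mem f ⟨hbW, hb⟩⟩
    · intro n
      split_ifs
      exacts [hW, hclosed _ h0]
  · rw [not_nonempty_iff_eq_empty, compl_empty_iff] at hne
    rw [hne, image_univ] at hW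
    exact Or.inl hW

/-! ### The main theorem -/

theorem mainTheorem9 (p : ℕ → unitInterval)
    (hp : ∀ n, 0 < (p n : ℝ) ∧ (p n : ℝ) ≤ 1 / 2)
    (F : Filter ℕ) (hproper : F.NeBot) (hnonprincipal : ∀ s : Set ℕ, F ≠ Filter.principal s)
    (hF : MeasurableSet[borel (ℕ → Bool)] (filterSet F) ∨ AnalyticSet (filterSet F)) :
    ∃ K : Set (ℕ → Bool), IsFSigma K ∧ cantorMeasure p K = 0 ∧ filterSet F ⊆ K := by
  have hA : AnalyticSet (filterSet F) := by
    refine hF.elim (fun h => ?_) id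
    have : PolishSpace Bool := (IsClosedEmbedding.of_continuous_injective_isClosedMap
      continuous_of_discreteTopology (f := Bool.toNat) (by decide)
      fun _ _ => isClosed_discrete _).polishSpace
    rw [← BorelSpace.measurable_eq] at h
    exact h.analyticSet
  rw [AnalyticSet] at hA
  rcases hA with hempty | ⟨f, hf, hrange⟩
  · exact ⟨∅, isClosed_empty.isFSigma, measure_empty, hempty.subset⟩
  rw [← hrange]
  refine (exists_null_isFSigma_or_kernel p f).resolve_right ?_
  rintro ⟨P, hne, hP⟩
  obtain ⟨x, hx, y, hy, z, hz, hfin⟩ := BranchNode.exists_range_inter_finite hp hf hP hne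
  rw [hrange] at hx hy hz
  obtain ⟨t, ht⟩ := Filter.exists_eq_principal_of_finite_mem (F := F) hfin
    (Filter.inter_mem hx (Filter.inter_mem hy hz))
  exact hnonprincipal t ht
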